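/- Let $\Omega\subset\mathbb{R}^d$ be a bounded open set, let $c>0$, and let $\kappa:\Omega\times\mathbb{R}^d\to[0,+\infty)$ and $\phi:\Omega\times\mathbb{R}^d\times\mathbb{R}^d\times\mathbb{R}^d\to[0,+\infty)$ satisfy, for all $x\in\Omega$ and $r,t,\xi\in\mathbb{R}^d$, $$\phi(x,r,t,\xi)=\kappa(x,\xi)\ \text{ if } r\neq t,\qquad \phi(x,r,r,\xi)=0,\qquad \phi(x,r,t,\xi)\ge c\ \text{ if } r\ne t \text{ and } |\xi|=1 .$$ A modulus of continuity is a nondecreasing function $\omega:[0,\infty)\to[0,\infty)$ with $\omega(0)=0$ that is continuous at $0$. Assume: - (K1) $\kappa(\cdot,\xi)\in W^{1,1}(\Omega)$ for all $\xi\in\mathbb{R}^d$; - (K2) there are a positive function $h\in L^1_{\rm loc}(\mathbb{R}^d)$, a modulus of continuity $\omega$ and representatives of the weak gradients $\nabla_x\kappa(\cdot,\xi)$ such that $|\nabla_x\kappa(x,\xi)-\nabla_x\kappa(x,\xi')|\le\omega(|\xi-\xi'|)\,h(x)$ for a.e. $x\in\Omega$ and all $\xi,\xi'\in\mathbb{R}^d$;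 - (K3) for every $x\in\Omega$ the function $\kappa(x,\cdot)$ is even, positively $1$-homogeneous and convex. Then $\phi$ is nonautonomous (NA) symmetric jointly convex, i.e. there is a sequence of bounded functions $g_j:\mathbb{R}^d\times\mathbb{R}^d\to\mathbb{R}^d$, $j\in\mathbb{N}$, such that $$\phi(x,r,t,\xi)=\sup_{j\in\mathbb{N}}\langle g_j(x,r)-g_j(x,t),\xi\rangle\qquad\text{for all }(x,r,t,\xi)\in\Omega\times\mathbb{R}^d\times\mathbb{R}^d\times\mathbb{R}^d,$$ and every $g=g_j$ has the following properties: - (G1) $g(\cdot,r)\in W^{1,1}_{\rm loc}(\mathbb{R}^d;\mathbb{R}^d)$ for all $r\in\mathbb{R}^d$, and there is a positive $h_1\in L^1_{\rm loc}(\mathbb{R}^d)$ with $|g(x,r)|\le h_1(x)$ for all $r\in\mathbb{R}^d$ and a.e. $x\in\mathbb{R}^d$; - (G2) there are a positive $h_2\in L^1_{\rm loc}(\mathbb{R}^d)$, a modulus of continuity $\omega$ with values in $[0,1]$ and representatives of the weak gradients $\nabla_x g(\cdot,r)$ such that $|\nabla_x g(x,r)-\nabla_x g(x,s)|\le\omega(|r-s|)\,h_2(x)$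 for a.e. $x\in\mathbb{R}^d$ and all $r,s\in\mathbb{R}^d$; - (G3') there is $L\ge 0$ such that $|g(x,r)-g(x,t)|\le L|r-t|$ for all $r,t\in\mathbb{R}^d$ and $\mathcal{H}^{d-1}$-a.e. $x\in\mathbb{R}^d$; - (G6) for $\mathcal{H}^{d-1}$-a.e. $x\in\mathbb{R}^d$ the vector field $g(x,\cdot)$ is conservative, i.e. $g(x,\cdot)=\nabla_r G(x,\cdot)$ for some $G(x,\cdot)\in C^1(\mathbb{R}^d)$. -/

import Mathlib

open MeasureTheory Topology
open scoped NNReal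

/-- The Euclidean space `ℝ^d`, with its Euclidean norm and Lebesgue measure. -/
abbrev RSp (d : ℕ) : Type := EuclideanSpace ℝ (Fin d)

/-- `Df` is the weak (distributional) derivative of `f` on the open set `Ω ⊆ ℝ^d`: both are in
`L¹_loc(Ω)` and `∫_Ω (∂_v ψ) f = - ∫_Ω ψ (Df v)` for all test functions `ψ ∈ C_c^∞(Ω)` and all
directions `v`. -/
def HasWeakDerivOn {d : ℕ} {F : Type*} [NormedAddCommGroup F] [NormedSpace ℝ F]
    (Ω : Set (RSp d)) (f : RSp d → F) (Df : RSp d → (RSp d →L[ℝ] F)) : Prop :=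
  LocallyIntegrableOn f Ω volume ∧ LocallyIntegrableOn Df Ω volume ∧
    ∀ ψ : RSp d → ℝ, ContDiff ℝ (⊤ : ℕ∞) ψ → HasCompactSupport ψ → tsupport ψ ⊆ Ω →
      ∀ v : RSp d, ∫ x in Ω, (fderiv ℝ ψ x v) • f x = -∫ x in Ω, ψ x • Df x v

/-- The Sobolev space `W^{1,1}(Ω; F)`. -/
def MemW11 {d : ℕ} {F : Type*} [NormedAddCommGroup F] [NormedSpace ℝ F]
    (Ω : Set (RSp d)) (f : RSp d → F) : Prop :=
  IntegrableOn f Ω volume ∧ ∃ Df : RSp d → (RSp d →L[ℝ] F),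
    IntegrableOn Df Ω volume ∧ HasWeakDerivOn Ω f Df

/-- The local Sobolev space `W^{1,1}_loc(ℝ^d; F)`. -/
def MemW11loc {d : ℕ} {F : Type*} [NormedAddCommGroup F] [NormedSpace ℝ F]
    (f : RSp d → F) : Prop :=
  ∃ Df : RSp d → (RSp d →L[ℝ] F), HasWeakDerivOn Set.univ f Df

/-- A modulus of continuity `ω : [0, ∞) → [0, ∞)`: nondecreasing, vanishing and continuous at `0`. -/
def IsModulus (ω : ℝ≥0 → ℝ≥0) : Prop :=
  Monotone ω ∧ ω 0 = 0 ∧ ContinuousAt ω 0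

/-- A positive function in `L¹_loc(ℝ^d)`. -/
def IsPosLocInt {d : ℕ} (h : RSp d → ℝ) : Prop :=
  (∀ x, 0 < h x) ∧ LocallyIntegrable h volume

/-- Sobolev regularity in `x` with an `L¹_loc` bound uniform in `r`. -/
def CondG1 {d : ℕ} (g : RSp d → RSp d → RSp d) : Prop :=
  (∀ r, MemW11loc (fun x => g x r)) ∧
    ∃ h₁ : RSp d → ℝ, IsPosLocInt h₁ ∧ ∀ᵐ x ∂volume, ∀ r, ‖g x r‖ ≤ h₁ x

/-- Equicontinuity in `r` of the weak gradient `∇_x g(x, r)`, with a modulus with values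
in `[0, 1]` and an `L¹_loc` weight; `Dg` is a representative of `∇_x g`. -/
def CondG2 {d : ℕ} (g : RSp d → RSp d → RSp d) : Prop :=
  ∃ Dg : RSp d → RSp d → (RSp d →L[ℝ] RSp d),
    (∀ r, HasWeakDerivOn Set.univ (fun x => g x r) (fun x => Dg x r)) ∧
    ∃ h₂ : RSp d → ℝ, IsPosLocInt h₂ ∧
      ∃ ω : ℝ≥0 → ℝ≥0, IsModulus ω ∧ (∀ s, ω s ≤ 1) ∧
        ∀ᵐ x ∂volume, ∀ r s, ‖Dg x r - Dg x s‖ ≤ (ω (nndist r s) : ℝ) * h₂ x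

/-- Lipschitz continuity in `r`, uniform for `ℋ^{d-1}`-a.e. `x`. -/
def CondG3' {d : ℕ} (g : RSp d → RSp d → RSp d) : Prop :=
  ∃ L : ℝ≥0, ∀ᵐ x ∂(μH[(d : ℝ) - 1] : Measure (RSp d)),
    ∀ r t, ‖g x r - g x t‖ ≤ (L : ℝ) * ‖r - t‖

/-- For `ℋ^{d-1}`-a.e. `x` the vector field `g(x, ·)` is conservative: it has a `C¹` potential. -/
def CondG6 {d : ℕ} (g : RSp d → RSp d → RSp d) : Prop :=
  ∃ N : Set (RSp d), (μH[(d : ℝ) - 1] : Measure (RSp d)) N = 0 ∧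
    ∀ x, x ∉ N → ∃ G : RSp d → ℝ, ContDiff ℝ 1 G ∧ ∀ r, HasGradientAt G (g x r) r

/-- Nonautonomous symmetric joint convexity of `φ : Ω × ℝ^d × ℝ^d × ℝ^d → [0, ∞)`.  Only the values
of `φ` at `x ∈ Ω` matter.  The fields `g j` are defined on `ℝ^d × ℝ^d`, where the conditions on them
are imposed, and they represent `φ` at all `x ∈ Ω`. -/
def IsNASymmetricJointlyConvex {d : ℕ} (Ω : Set (RSp d))
    (φ : RSp d → RSp d → RSp d → RSp d → ℝ) : Prop :=
  (∀ x ∈ Ω, ∀ r t ξ, 0 ≤ φ x r t ξ) ∧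
  ∃ g : ℕ → RSp d → RSp d → RSp d,
    (∀ j, ∃ C : ℝ, ∀ x r, ‖g j x r‖ ≤ C) ∧
    (∀ x ∈ Ω, ∀ r t ξ,
      IsLUB (Set.range fun j => inner ℝ (g j x r - g j x t) ξ) (φ x r t ξ)) ∧
    ∀ j, CondG1 (g j) ∧ CondG2 (g j) ∧ CondG3' (g j) ∧ CondG6 (g j)

/-! Every field has the separated form `g(x, r) = l(x) τ(⟪p, r⟫) p`, with `p` a fixed vector, `τ` a
Lipschitz ramp with values in `[0, 1]` and `l` a Sobolev weight with values in `[0, 1]`.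
Conservativity in `r` holds because a primitive of `τ` composed with `⟪p, ·⟫` is a potential, and
the regularity in `x` is that of `l`.

Upper bound: `l` vanishes wherever `|⟪p, ·⟫| ≤ κ(x, ·)` fails, and differences of `τ` lie in `[-1,
1]`, so no field exceeds `κ(x, ξ)`. Sharpness: for `r ≠ t`, Hahn-Banach gives a functional below
`κ(x, ·)` that touches it at `ξ`. Since `κ(x, ·) ≥ c` on the unit sphere, it can be shrunk and
perturbed to a `p` in a countable dense set that stays strictly below `κ(x, ·)`, is almost optimal
at `ξ`, and satisfies `⟪p, r⟫ ≠ ⟪p, t⟫`. A ramp with rational data then takes the values `1` and `0`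
at these two numbers, and countably many parameters suffice.

The main difficulty is the weight (`exists_sobolev_weight`): the constraint involves infinitely many
`ξ`, but by sublinearity it follows, with a margin, from its validity on a finite net of the sphere.
Hence `l` can be a smooth function of finitely many cut-off functions `κ(·, ξ)`, and the Sobolev
chain rule applies. -/

section Sobolev

open Filter ContinuousLinearMap Convolution

/-! ### Mollification of integrable and weakly differentiable maps. -/

section Mollification

variable {d : ℕ} {E : Type*} [NormedAddCommGroup E] [NormedSpace ℝ E]

/-- Convolution with a normalized bump function does not increase the `L¹` norm. -/
theorem integral_norm_normed_convolution_le (ρ : ContDiffBump (0 : RSp d)) {f : RSp d → E}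
    (hf : Integrable f) :
    ∫ x, ‖(ρ.normed volume ⋆[lsmul ℝ ℝ] f) x‖ ≤ ∫ x, ‖f x‖ := by
  have hρ : Integrable (ρ.normed volume) := ρ.integrable_normed
  calc ∫ x, ‖(ρ.normed volume ⋆[lsmul ℝ ℝ] f) x‖
      ≤ ∫ x, (ρ.normed volume ⋆[lsmul ℝ ℝ] fun y => ‖f y‖) x := by
        refine integral_mono (hρ.integrable_convolution _ hf).norm
          (hρ.integrable_convolution _ hf.norm) fun x => ?_
        simp only [convolution_def, lsmul_apply, smul_eq_mul]
        refine (norm_integral_le_integral_norm _).trans_eq ?_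
        refine integral_congr_ae (Eventually.of_forall fun t => ?_)
        simp [norm_smul, abs_of_nonneg (ρ.nonneg_normed t)]
    _ = ∫ x, ‖f x‖ := by
        rw [integral_convolution _ hρ hf.norm, ρ.integral_normed]
        simp

/-- A sequence of bump functions on `ℝ^d` with supports shrinking to the origin. -/
noncomputable def shrinkingBump (d n : ℕ) : ContDiffBump (0 : RSp d) :=
  ⟨1 / ((n : ℝ) + 1), 2 * (1 / ((n : ℝ) + 1)), by positivity, by
    have : 0 < 1 / ((n : ℝ) + 1) := by positivity
    linarith⟩

/-- Regularization of `f` by convolution with `shrinkingBump d n`. -/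
noncomputable def mollify (n : ℕ) (f : RSp d → E) : RSp d → E :=
  (shrinkingBump d n).normed volume ⋆[lsmul ℝ ℝ] f

/-- Lebesgue differentiation: the outer radius of each bump is twice the inner one, so the kernels
are controlled by averages over balls, uniformly in `n`. -/
theorem tendsto_mollify_ae [CompleteSpace E] {f : RSp d → E} (hf : LocallyIntegrable f) :
    ∀ᵐ x, Tendsto (fun n => mollify n f x) atTop (𝓝 (f x)) := by
  refine ContDiffBump.ae_convolution_tendsto_right_of_locallyIntegrable (K := 2) ?_
    (Eventually.of_forall fun n => le_rfl) hf
  have := (tendsto_one_div_add_atTop_nhds_zero_nat (𝕜 := ℝ)).const_mul 2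
  simpa [shrinkingBump] using this

theorem integrable_mollify (n : ℕ) {f : RSp d → E} (hf : Integrable f) :
    Integrable (mollify n f) :=
  (ContDiffBump.integrable_normed _).integrable_convolution _ hf

/-- Mollifications of an integrable function converge to it in `L¹`. -/
theorem tendsto_integral_norm_mollify_sub [CompleteSpace E] {f : RSp d → E} (hf : Integrable f) :
    Tendsto (fun n => ∫ x, ‖mollify n f x - f x‖) atTop (𝓝 0) := by
  have hI : ∀ n, Integrable (mollify n f) := fun n => integrable_mollify n hf
  -- By the triangle inequality this integrand lies between `0` and `2‖f‖`, so dominated convergence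
  -- applies although the mollifications have no common majorant. The contraction of the `L¹` norm
  -- then discards the last two terms.
  have h0 : Tendsto (fun n => ∫ x, (‖mollify n f x - f x‖ + ‖f x‖ - ‖mollify n f x‖))
      atTop (𝓝 (∫ _ : RSp d, (0 : ℝ))) := by
    refine tendsto_integral_of_dominated_convergence (fun x => 2 * ‖f x‖)
      (fun n => ((((hI n).sub hf).norm.add hf.norm).sub (hI n).norm).aestronglyMeasurable)
      (hf.norm.const_mul 2) (fun n => Eventually.of_forall fun x => ?_) ?_
    · have h1 := norm_sub_le (mollify n f x) (f x)
      have h2 := norm_add_le (mollify n f x - f x) (f x)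
      rw [sub_add_cancel] at h2
      rw [Real.norm_of_nonneg (by linarith)]
      linarith
    · filter_upwards [tendsto_mollify_ae hf.locallyIntegrable] with x hx
      have h1 : Tendsto (fun n => ‖mollify n f x - f x‖) atTop (𝓝 0) := by
        simpa using (hx.sub_const (f x)).norm
      simpa using (h1.add_const ‖f x‖).sub hx.norm
  rw [integral_zero] at h0
  refine squeeze_zero (fun n => integral_nonneg fun x => norm_nonneg _) (fun n => ?_) h0
  have hs : Integrable (fun x => ‖mollify n f x - f x‖) := ((hI n).sub hf).norm
  have hs' : Integrable (fun x => ‖mollify n f x - f x‖ + ‖f x‖) := hs.add hf.norm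
  rw [integral_sub hs' (hI n).norm, integral_add hs hf.norm]
  have := integral_norm_normed_convolution_le (shrinkingBump d n) hf
  simp only [mollify] at this ⊢
  linarith

/-- Mollification commutes with weak differentiation. -/
theorem hasFDerivAt_mollify [CompleteSpace E] {f : RSp d → E} {Df : RSp d → (RSp d →L[ℝ] E)}
    (h : HasWeakDerivOn Set.univ f Df) (n : ℕ) (x : RSp d) :
    HasFDerivAt (mollify n f) (mollify n Df x) x := by
  obtain ⟨hf, hDf, hw⟩ := h
  rw [locallyIntegrableOn_univ] at hf hDf
  set ρ := (shrinkingBump d n).normed volume with hρ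
  have hρs : ContDiff ℝ (⊤ : ℕ∞) ρ := ContDiffBump.contDiff_normed _
  have hρc : HasCompactSupport ρ := ContDiffBump.hasCompactSupport_normed _
  have key := hρc.hasFDerivAt_convolution_left (lsmul ℝ ℝ) (μ := volume)
    (hρs.of_le (by exact_mod_cast le_top)) hf x
  suffices heq : mollify n Df x = (fderiv ℝ ρ ⋆[(lsmul ℝ ℝ).precompL (RSp d)] f) x by
    rw [heq]
    exact key
  refine ContinuousLinearMap.ext fun v => ?_
  have hc1 : ConvolutionExistsAt ρ Df x (lsmul ℝ ℝ) volume :=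
    hρc.convolutionExists_left _ hρs.continuous hDf x
  have hc2 : ConvolutionExistsAt (fderiv ℝ ρ) f x ((lsmul ℝ ℝ).precompL (RSp d)) volume :=
    (hρc.fderiv ℝ).convolutionExists_left _ (hρs.continuous_fderiv (by simp)) hf x
  change (ρ ⋆[lsmul ℝ ℝ] Df) x v = _
  rw [convolution_eq_swap, convolution_eq_swap,
    ContinuousLinearMap.integral_apply hc1.integrable_swap,
    ContinuousLinearMap.integral_apply hc2.integrable_swap]
  simp only [lsmul_apply, precompL_apply, smul_apply]
  -- The weak derivative is tested with `y ↦ ρ (x - y)`; the sign from the reflection cancels the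
  -- one from integration by parts.
  have hd : ∀ y, HasFDerivAt (fun y => ρ (x - y)) (-(fderiv ℝ ρ (x - y))) y := fun y => by
    have h1 := ((hρs.differentiable (by simp)).differentiableAt (x := x - y)).hasFDerivAt
    have h2 : HasFDerivAt (fun y => x - y) (-(ContinuousLinearMap.id ℝ (RSp d))) y :=
      (hasFDerivAt_id y).const_sub x
    have h3 := h1.comp y h2
    rwa [comp_neg, comp_id] at h3
  have h1 := hw (fun y => ρ (x - y)) (hρs.comp (contDiff_const.sub contDiff_id))
    (hρc.comp_homeomorph (Homeomorph.subLeft x)) (Set.subset_univ _) v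
  simp only [Measure.restrict_univ] at h1
  rw [eq_comm, ← neg_inj, ← h1, ← integral_neg]
  refine integral_congr_ae (Eventually.of_forall fun y => ?_)
  simp [(hd y).fderiv]

end Mollification

/-! ### Chain rule, cutoffs and products for weak derivatives. -/

/-- Chain rule for an integrable Sobolev map and a smooth function with compact support. -/
theorem HasWeakDerivOn.comp_contDiff {d : ℕ} {E : Type*} [NormedAddCommGroup E] [NormedSpace ℝ E]
    [CompleteSpace E] {f : RSp d → E} {Df : RSp d → (RSp d →L[ℝ] E)}
    (h : HasWeakDerivOn Set.univ f Df) (hf : Integrable f) (hDf : Integrable Df)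
    {Φ : E → ℝ} (hΦ : ContDiff ℝ (⊤ : ℕ∞) Φ) (hΦc : HasCompactSupport Φ) :
    HasWeakDerivOn Set.univ (fun x => Φ (f x)) (fun x => (fderiv ℝ Φ (f x)).comp (Df x)) := by
  have hΦd : Continuous (fderiv ℝ Φ) := hΦ.continuous_fderiv (by simp)
  obtain ⟨A, hA⟩ := hΦc.exists_bound_of_continuous hΦ.continuous
  obtain ⟨B, hB⟩ := (hΦc.fderiv ℝ).exists_bound_of_continuous hΦd
  have hB0 : 0 ≤ B := (norm_nonneg _).trans (hB 0)
  have hmeas : ∀ {u : RSp d → E} {Du : RSp d → (RSp d →L[ℝ] E)}, AEStronglyMeasurable u volume →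
      AEStronglyMeasurable Du volume →
      AEStronglyMeasurable (fun x => (fderiv ℝ Φ (u x)).comp (Du x)) volume := fun hu hDu =>
    (compL ℝ (RSp d) E ℝ).aestronglyMeasurable_comp₂ (hΦd.comp_aestronglyMeasurable hu) hDu
  have hcomp : ∀ (y : E) (T : RSp d →L[ℝ] E), ‖(fderiv ℝ Φ y).comp T‖ ≤ B * ‖T‖ := fun y T =>
    (opNorm_comp_le _ _).trans (mul_le_mul_of_nonneg_right (hB y) (norm_nonneg _))
  have hint : ∀ {u : RSp d → E} {Du : RSp d → (RSp d →L[ℝ] E)}, AEStronglyMeasurable u volume →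
      Integrable Du → Integrable (fun x => (fderiv ℝ Φ (u x)).comp (Du x)) := fun hu hDu =>
    (hDu.norm.const_mul B).mono' (hmeas hu hDu.1) (Eventually.of_forall fun x => hcomp _ _)
  have hΦm : ∀ {u : RSp d → E}, AEStronglyMeasurable u volume →
      LocallyIntegrable (fun x => Φ (u x)) := fun hu =>
    (locallyIntegrable_const A).mono (hΦ.continuous.comp_aestronglyMeasurable hu)
      (Eventually.of_forall fun x => (hA _).trans (Real.le_norm_self A))
  refine ⟨(hΦm hf.1).locallyIntegrableOn _, (hint hf.1 hDf).locallyIntegrable.locallyIntegrableOn _,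
    fun ψ hψ hψc _ v => ?_⟩
  simp only [Measure.restrict_univ]
  have hψd : Continuous (fderiv ℝ ψ) := hψ.continuous_fderiv (by simp)
  have hψdv : Continuous (fun x => fderiv ℝ ψ x v) := hψd.clm_apply continuous_const
  have hψdc : HasCompactSupport (fun x => fderiv ℝ ψ x v) := hψc.fderiv_apply ℝ v
  obtain ⟨C, hC⟩ := hψc.exists_bound_of_continuous hψ.continuous
  have hC0 : 0 ≤ C := (norm_nonneg _).trans (hC 0)
  have hfn : ∀ n, Integrable (mollify n f) := fun n => integrable_mollify n hf
  have hDn : ∀ n, Integrable (mollify n Df) := fun n => integrable_mollify n hDf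
  -- the identity for the mollified functions
  have hn : ∀ n, ∫ x, fderiv ℝ ψ x v • Φ (mollify n f x) =
      -∫ x, ψ x • (fderiv ℝ Φ (mollify n f x)).comp (mollify n Df x) v := fun n => by
    have hder : ∀ x, HasFDerivAt (fun x => Φ (mollify n f x))
        ((fderiv ℝ Φ (mollify n f x)).comp (mollify n Df x)) x := fun x =>
      ((hΦ.differentiable (by simp)).differentiableAt.hasFDerivAt).comp x
        (hasFDerivAt_mollify h n x)
    have := integral_bilinear_hasFDerivAt_right_eq_neg_left_of_integrable (μ := volume) (v := v)
      (B := lsmul ℝ ℝ) (f := ψ) (f' := fderiv ℝ ψ) (g := fun x => Φ (mollify n f x))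
      (g' := fun x => (fderiv ℝ Φ (mollify n f x)).comp (mollify n Df x))
      ((hΦm (hfn n).1).integrable_smul_left_of_hasCompactSupport hψdv hψdc)
      (((hint (hfn n).1 (hDn n)).apply_continuousLinearMap v).locallyIntegrable
        |>.integrable_smul_left_of_hasCompactSupport hψ.continuous hψc)
      ((hΦm (hfn n).1).integrable_smul_left_of_hasCompactSupport hψ.continuous hψc)
      (fun x _ => (hψ.differentiable (by simp)).differentiableAt.hasFDerivAt)
      (fun x _ => hder x)
    simp only [lsmul_apply] at this
    rw [this, neg_neg]
  have hae := tendsto_mollify_ae hf.locallyIntegrable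
  have hlim1 : Tendsto (fun n => ∫ x, fderiv ℝ ψ x v • Φ (mollify n f x)) atTop
      (𝓝 (∫ x, fderiv ℝ ψ x v • Φ (f x))) := by
    refine tendsto_integral_of_dominated_convergence (fun x => ‖fderiv ℝ ψ x v‖ * A)
      (fun n => ((hΦm (hfn n).1).integrable_smul_left_of_hasCompactSupport hψdv hψdc).1)
      ((hψdv.integrable_of_hasCompactSupport hψdc).norm.mul_const A)
      (fun n => Eventually.of_forall fun x => ?_) ?_
    · rw [norm_smul]
      exact mul_le_mul_of_nonneg_left (hA _) (norm_nonneg _)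
    · filter_upwards [hae] with x hx
      exact ((hΦ.continuous.tendsto _).comp hx).const_smul _
  have hψint : ∀ {u : RSp d → E} {Du : RSp d → (RSp d →L[ℝ] E)}, AEStronglyMeasurable u volume →
      Integrable Du → Integrable (fun x => ψ x • (fderiv ℝ Φ (u x)).comp (Du x) v) :=
    fun hu hDu => ((hint hu hDu).apply_continuousLinearMap v).locallyIntegrable
        |>.integrable_smul_left_of_hasCompactSupport hψ.continuous hψc
  have hbd : ∀ x y (T : RSp d →L[ℝ] E),
      ‖ψ x • (fderiv ℝ Φ y).comp T v‖ ≤ C * (B * ‖v‖) * ‖T‖ := fun x y T => by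
    rw [norm_smul, mul_assoc]
    refine mul_le_mul (hC x) ?_ (norm_nonneg _) hC0
    calc ‖(fderiv ℝ Φ y).comp T v‖ ≤ ‖(fderiv ℝ Φ y).comp T‖ * ‖v‖ := le_opNorm _ _
      _ ≤ B * ‖T‖ * ‖v‖ := mul_le_mul_of_nonneg_right (hcomp y T) (norm_nonneg _)
      _ = B * ‖v‖ * ‖T‖ := by ring
  -- The derivative term is split by writing `mollify n Df` as `Df` plus an error: the first part
  -- converges by domination, the second is bounded by a multiple of the `L¹` error.
  have hlim2 : Tendsto (fun n => ∫ x, ψ x • (fderiv ℝ Φ (mollify n f x)).comp (Df x) v) atTop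
      (𝓝 (∫ x, ψ x • (fderiv ℝ Φ (f x)).comp (Df x) v)) := by
    refine tendsto_integral_of_dominated_convergence (fun x => C * (B * ‖v‖) * ‖Df x‖)
      (fun n => (hψint (hfn n).1 hDf).1) (hDf.norm.const_mul _)
      (fun n => Eventually.of_forall fun x => hbd x _ _) ?_
    filter_upwards [hae] with x hx
    have hx' : Tendsto (fun n => fderiv ℝ Φ (mollify n f x)) atTop (𝓝 (fderiv ℝ Φ (f x))) :=
      (hΦd.tendsto _).comp hx
    exact (((ContinuousLinearMap.apply ℝ ℝ (Df x v)).continuous.tendsto _).comp hx').const_smul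
      (ψ x)
  have hlim3 : Tendsto (fun n => ∫ x, ψ x •
      (fderiv ℝ Φ (mollify n f x)).comp (mollify n Df x - Df x) v) atTop (𝓝 0) := by
    refine squeeze_zero_norm (fun n => ?_) (by
      simpa using (tendsto_integral_norm_mollify_sub hDf).const_mul (C * (B * ‖v‖)))
    refine (norm_integral_le_of_norm_le (((hDn n).sub hDf).norm.const_mul (C * (B * ‖v‖)))
      (Eventually.of_forall fun x => hbd x _ _)).trans_eq ?_
    rw [integral_const_mul]
    rfl
  have hlim4 : Tendsto (fun n => ∫ x, ψ x • (fderiv ℝ Φ (mollify n f x)).comp (mollify n Df x) v)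
      atTop (𝓝 (∫ x, ψ x • (fderiv ℝ Φ (f x)).comp (Df x) v)) := by
    have := hlim2.add hlim3
    rw [add_zero] at this
    refine this.congr fun n => ?_
    have hs : Integrable (fun x => mollify n Df x - Df x) := (hDn n).sub hDf
    rw [← integral_add (hψint (hfn n).1 hDf) (hψint (hfn n).1 hs)]
    refine integral_congr_ae (Eventually.of_forall fun x => ?_)
    simp [mul_sub]
  exact tendsto_nhds_unique (hlim1.congr hn) hlim4.neg

/-- Multiplying a function that is integrable on `K` by a continuous function supported in `K`. -/
theorem integrable_smul_of_tsupport_subset {X F : Type*} [TopologicalSpace X] [T2Space X]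
    [MeasurableSpace X] [OpensMeasurableSpace X] {μ : Measure X} [IsFiniteMeasureOnCompacts μ]
    [NormedAddCommGroup F]
    [NormedSpace ℝ F] {a : X → ℝ} {f : X → F} (ha : Continuous a) (hac : HasCompactSupport a)
    {K : Set X} (hK : MeasurableSet K) (haK : tsupport a ⊆ K) (hf : IntegrableOn f K μ) :
    Integrable (fun x => a x • f x) μ := by
  convert ((integrable_indicator_iff hK).2 hf).locallyIntegrable
    |>.integrable_smul_left_of_hasCompactSupport ha hac using 1
  funext x
  by_cases hx : x ∈ K
  · rw [Set.indicator_of_mem hx]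
  · rw [image_eq_zero_of_notMem_tsupport fun h => hx (haK h), zero_smul, zero_smul]

/-- A compactly supported smooth cutoff inside `Ω` turns a function with a weak derivative on `Ω`
into an integrable function with an integrable weak derivative on the whole space. -/
theorem HasWeakDerivOn.cutoff_mul {d : ℕ} {Ω : Set (RSp d)} {f : RSp d → ℝ}
    {Df : RSp d → (RSp d →L[ℝ] ℝ)} (h : HasWeakDerivOn Ω f Df) {ζ : RSp d → ℝ}
    (hζ : ContDiff ℝ (⊤ : ℕ∞) ζ) (hζc : HasCompactSupport ζ) (hζΩ : tsupport ζ ⊆ Ω) :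
    Integrable (fun x => ζ x * f x) ∧
      Integrable (fun x => ζ x • Df x + f x • fderiv ℝ ζ x) ∧
      HasWeakDerivOn Set.univ (fun x => ζ x * f x)
        (fun x => ζ x • Df x + f x • fderiv ℝ ζ x) := by
  obtain ⟨hf, hDf, hw⟩ := h
  have hζd : Continuous (fderiv ℝ ζ) := hζ.continuous_fderiv (by simp)
  have hK : MeasurableSet (tsupport ζ) := (isClosed_tsupport ζ).measurableSet
  have hfK := hf.integrableOn_compact_subset hζΩ hζc
  have hDfK := hDf.integrableOn_compact_subset hζΩ hζc
  have h1 : Integrable (fun x => ζ x * f x) :=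
    integrable_smul_of_tsupport_subset hζ.continuous hζc hK subset_rfl hfK
  have h2 : Integrable (fun x => f x • fderiv ℝ ζ x) := by
    refine (((integrable_indicator_iff hK).2 hfK).locallyIntegrable
      |>.integrable_smul_right_of_hasCompactSupport hζd (hζc.fderiv ℝ)).congr
        (Eventually.of_forall fun x => ?_)
    beta_reduce
    by_cases hx : x ∈ tsupport ζ
    · rw [Set.indicator_of_mem hx]
    · rw [image_eq_zero_of_notMem_tsupport fun h => hx (tsupport_fderiv_subset ℝ h), smul_zero,
        smul_zero]
  have h3 : Integrable (fun x => ζ x • Df x + f x • fderiv ℝ ζ x) :=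
    (integrable_smul_of_tsupport_subset hζ.continuous hζc hK subset_rfl hDfK).add h2
  refine ⟨h1, h3, h1.locallyIntegrable.locallyIntegrableOn _,
    h3.locallyIntegrable.locallyIntegrableOn _, fun ψ hψ hψc _ v => ?_⟩
  have hψd : Continuous (fderiv ℝ ψ) := hψ.continuous_fderiv (by simp)
  have hsub : tsupport (fun x => ψ x * ζ x) ⊆ Ω :=
    (tsupport_mul_subset_right (f := ψ) (g := ζ)).trans hζΩ
  -- The product `ψ ζ` is admissible on `Ω` even when `ψ` is not; its extra term `ψ ∇ζ` yields the
  -- second summand of the new derivative.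
  have key := hw (fun x => ψ x * ζ x) (hψ.mul hζ) (hψc.mul_right (f' := ζ)) hsub v
  have hd : ∀ x, fderiv ℝ (fun x => ψ x * ζ x) x v =
      fderiv ℝ ψ x v * ζ x + ψ x * fderiv ℝ ζ x v := fun x => by
    rw [fderiv_fun_mul (hψ.differentiable (by simp)).differentiableAt
      (hζ.differentiable (by simp)).differentiableAt]
    simp only [add_apply, smul_apply, smul_eq_mul]
    ring
  have hz : ∀ x, x ∉ Ω → ζ x = 0 := fun x hx =>
    image_eq_zero_of_notMem_tsupport fun h => hx (hζΩ h)
  have hz' : ∀ x, x ∉ Ω → fderiv ℝ ζ x = 0 := fun x hx =>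
    image_eq_zero_of_notMem_tsupport fun h => hx (hζΩ (tsupport_fderiv_subset ℝ h))
  rw [setIntegral_eq_integral_of_forall_compl_eq_zero (fun x hx => by
      rw [hd, hz x hx, hz' x hx]; simp),
    setIntegral_eq_integral_of_forall_compl_eq_zero (fun x hx => by rw [hz x hx]; simp)] at key
  simp only [Measure.restrict_univ]
  have i1 : Integrable (fun x => fderiv ℝ ψ x v • (ζ x * f x)) :=
    h1.locallyIntegrable.integrable_smul_left_of_hasCompactSupport
      (hψd.clm_apply continuous_const) (hψc.fderiv_apply ℝ v)
  have i2 : Integrable (fun x => ψ x • (f x • fderiv ℝ ζ x v)) :=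
    (h2.apply_continuousLinearMap v).locallyIntegrable.integrable_smul_left_of_hasCompactSupport
      hψ.continuous hψc
  have i3 : Integrable (fun x => ψ x • (ζ x • Df x + f x • fderiv ℝ ζ x) v) :=
    (h3.apply_continuousLinearMap v).locallyIntegrable.integrable_smul_left_of_hasCompactSupport
      hψ.continuous hψc
  have e1 : ∀ x, fderiv ℝ (fun x => ψ x * ζ x) x v • f x =
      fderiv ℝ ψ x v • (ζ x * f x) + ψ x • (f x • fderiv ℝ ζ x v) := fun x => by
    rw [hd]
    simp only [smul_eq_mul]
    ring
  have e2 : ∀ x, (ψ x * ζ x) • Df x v = ψ x • (ζ x • Df x + f x • fderiv ℝ ζ x) v -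
      ψ x • (f x • fderiv ℝ ζ x v) := fun x => by
    simp only [add_apply, smul_apply, smul_eq_mul]
    ring
  simp only [e1, e2] at key
  rw [integral_add i1 i2, integral_sub i3 i2] at key
  linarith

theorem integrable_clm_pi {X V ι : Type*} [MeasurableSpace X] {μ : Measure X}
    [NormedAddCommGroup V] [NormedSpace ℝ V] [Fintype ι] {D : ι → X → V →L[ℝ] ℝ}
    (hD : ∀ i, Integrable (D i) μ) :
    Integrable (fun x => ContinuousLinearMap.pi fun i => D i x) μ := by
  classical
  have hL : ∀ i, Integrable
      (fun x => (ContinuousLinearMap.single ℝ (fun _ => ℝ) i).comp (D i x)) μ := fun i => ((compL ℝ V ℝ (ι → ℝ)) (ContinuousLinearMap.single ℝ (fun _ => ℝ) i)).integrable_comp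
      (hD i)
  have hs := integrable_finsetSum (ε' := V →L[ℝ] (ι → ℝ)) Finset.univ fun i _ => hL i
  refine hs.congr (Eventually.of_forall fun x => ?_)
  ext v j
  simp [Finset.sum_apply, Pi.single_apply]

/-- Weak derivatives of maps into a finite product are computed componentwise. -/
theorem HasWeakDerivOn.pi {d : ℕ} {ι : Type*} [Fintype ι] {f : RSp d → ι → ℝ}
    {Df : ι → RSp d → (RSp d →L[ℝ] ℝ)} (hf : ∀ i, Integrable (fun x => f x i))
    (hDf : ∀ i, Integrable (Df i))
    (h : ∀ i, HasWeakDerivOn Set.univ (fun x => f x i) (Df i)) :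
    Integrable f ∧ Integrable (fun x => ContinuousLinearMap.pi fun i => Df i x) ∧
      HasWeakDerivOn Set.univ f (fun x => ContinuousLinearMap.pi fun i => Df i x) := by
  have h1 : Integrable f := Integrable.of_eval hf
  have h2 : Integrable (fun x => ContinuousLinearMap.pi fun i => Df i x) := integrable_clm_pi hDf
  refine ⟨h1, h2, h1.locallyIntegrable.locallyIntegrableOn _,
    h2.locallyIntegrable.locallyIntegrableOn _, fun ψ hψ hψc hψΩ v => ?_⟩
  have hψd : Continuous (fderiv ℝ ψ) := hψ.continuous_fderiv (by simp)
  have i1 : Integrable (fun x => fderiv ℝ ψ x v • f x) :=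
    h1.locallyIntegrable.integrable_smul_left_of_hasCompactSupport
      (hψd.clm_apply continuous_const) (hψc.fderiv_apply ℝ v)
  have i2 : Integrable (fun x => ψ x • (ContinuousLinearMap.pi fun i => Df i x) v) :=
    (h2.apply_continuousLinearMap v).locallyIntegrable.integrable_smul_left_of_hasCompactSupport
      hψ.continuous hψc
  simp only [Measure.restrict_univ]
  funext i
  rw [Pi.neg_apply, eval_integral fun j => i1.eval j, eval_integral fun j => i2.eval j]
  simpa using (h i).2.2 ψ hψ hψc hψΩ v

/-- A smooth compactly supported function of finitely many cut-off Sobolev functions has an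
integrable weak derivative. -/
theorem exists_integrable_hasWeakDerivOn_comp_cutoff {d : ℕ} {Ω : Set (RSp d)}
    {ι : Type*} [Fintype ι] {u : ι → RSp d → ℝ} (hu : ∀ i, MemW11 Ω (u i)) {ζ : RSp d → ℝ}
    (hζ : ContDiff ℝ (⊤ : ℕ∞) ζ) (hζc : HasCompactSupport ζ) (hζΩ : tsupport ζ ⊆ Ω)
    {Φ : (ι → ℝ) → ℝ} (hΦ : ContDiff ℝ (⊤ : ℕ∞) Φ) (hΦc : HasCompactSupport Φ) :
    ∃ D : RSp d → (RSp d →L[ℝ] ℝ), Integrable D ∧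
      HasWeakDerivOn Set.univ (fun x => Φ fun i => ζ x * u i x) D := by
  choose Du _ hDu using fun i => (hu i).2
  have h := fun i => (hDu i).cutoff_mul hζ hζc hζΩ
  obtain ⟨h1, h2, h3⟩ := HasWeakDerivOn.pi (fun i => (h i).1) (fun i => (h i).2.1)
    (fun i => (h i).2.2)
  have h4 := h3.comp_contDiff h1 h2 hΦ hΦc
  refine ⟨_, ?_, h4⟩
  obtain ⟨B, hB⟩ := (hΦc.fderiv ℝ).exists_bound_of_continuous (hΦ.continuous_fderiv (by simp))
  exact (h2.norm.const_mul B).mono' (locallyIntegrableOn_univ.1 h4.2.1).aestronglyMeasurable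
    (Eventually.of_forall fun x =>
      (opNorm_comp_le _ _).trans (mul_le_mul_of_nonneg_right (hB _) (norm_nonneg _)))

end Sobolev

/-! ### Symmetric sublinear functions and their supporting functionals. -/

open Filter

/-- Even, positively `1`-homogeneous convex functions on a real vector space. -/
structure IsSymmSublinear {V : Type*} [AddCommGroup V] [Module ℝ V] (k : V → ℝ) : Prop where
  even : ∀ ξ, k (-ξ) = k ξ
  smul_pos : ∀ s : ℝ, 0 < s → ∀ ξ, k (s • ξ) = s * k ξ
  convexOn : ConvexOn ℝ Set.univ k

namespace IsSymmSublinear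

section Module

variable {V : Type*} [AddCommGroup V] [Module ℝ V] {k : V → ℝ}

theorem map_zero (hk : IsSymmSublinear k) : k 0 = 0 := by
  have := hk.smul_pos 2 two_pos 0
  rw [smul_zero] at this
  linarith

theorem map_add_le (hk : IsSymmSublinear k) (x y : V) : k (x + y) ≤ k x + k y := by
  have h := hk.convexOn.2 (Set.mem_univ x) (Set.mem_univ y)
    (by norm_num : (0 : ℝ) ≤ 1 / 2) (by norm_num : (0 : ℝ) ≤ 1 / 2) (by norm_num)
  rw [← smul_add, hk.smul_pos _ (by norm_num), smul_eq_mul, smul_eq_mul] at h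
  linarith

theorem nonneg (hk : IsSymmSublinear k) (x : V) : 0 ≤ k x := by
  have h := hk.map_add_le x (-x)
  rw [add_neg_cancel, hk.map_zero, hk.even] at h
  linarith

theorem map_smul (hk : IsSymmSublinear k) (s : ℝ) (x : V) : k (s • x) = |s| * k x := by
  rcases lt_trichotomy s 0 with h | h | h
  · rw [abs_of_neg h, ← hk.smul_pos _ (neg_pos.2 h), neg_smul, hk.even]
  · simp [h, hk.map_zero]
  · rw [abs_of_pos h, hk.smul_pos _ h]

theorem const_mul (hk : IsSymmSublinear k) {a : ℝ} (ha : 0 ≤ a) :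
    IsSymmSublinear fun x => a * k x where
  even ξ := by rw [hk.even]
  smul_pos s hs ξ := by rw [hk.smul_pos s hs]; ring
  convexOn := hk.convexOn.smul ha

end Module

variable {d : ℕ} {k : RSp d → ℝ}

theorem le_of_basis_le (hk : IsSymmSublinear k) {M : ℝ}
    (hM : ∀ i, k (EuclideanSpace.basisFun (Fin d) ℝ i) ≤ M) (η : RSp d) :
    k η ≤ d * M * ‖η‖ := by
  conv_lhs => rw [← (EuclideanSpace.basisFun (Fin d) ℝ).sum_repr η]
  refine (Finset.le_sum_of_subadditive k hk.map_zero.le hk.map_add_le _ _).trans ?_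
  calc ∑ i, k ((EuclideanSpace.basisFun (Fin d) ℝ).repr η i • EuclideanSpace.basisFun (Fin d) ℝ i)
      ≤ ∑ _i : Fin d, ‖η‖ * M := by
        refine Finset.sum_le_sum fun i _ => ?_
        rw [hk.map_smul]
        refine mul_le_mul ?_ (hM i) (hk.nonneg _) (norm_nonneg _)
        simpa using PiLp.norm_apply_le η i
    _ = d * M * ‖η‖ := by
        rw [Finset.sum_const, Finset.card_univ, Fintype.card_fin, nsmul_eq_mul]
        ring

theorem abs_inner_le_of_unit (hk : IsSymmSublinear k) {p : RSp d}
    (h : ∀ η : RSp d, ‖η‖ = 1 → |inner ℝ p η| ≤ k η) (η : RSp d) : |inner ℝ p η| ≤ k η := by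
  rcases eq_or_ne η 0 with rfl | hη
  · simp [hk.map_zero]
  have hη' : 0 < ‖η‖ := norm_pos_iff.2 hη
  have h1 := h (‖η‖⁻¹ • η) (by rw [norm_smul, norm_inv, norm_norm, inv_mul_cancel₀ hη'.ne'])
  rw [inner_smul_right, abs_mul, hk.map_smul] at h1
  exact le_of_mul_le_mul_left h1 (abs_pos.2 (inv_pos.2 hη').ne')

/-- A strict lower bound by `|⟪p, ·⟫|` on a fine net of the unit sphere propagates to the space. -/
theorem abs_inner_le_of_net (hk : IsSymmSublinear k) {p : RSp d} {T : Set (RSp d)} {ε δ M : ℝ}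
    (hb : ∀ i, EuclideanSpace.basisFun (Fin d) ℝ i ∈ T)
    (hT : ∀ η : RSp d, ‖η‖ = 1 → ∃ ξ ∈ T, ‖η - ξ‖ ≤ δ) (hM : 0 ≤ M)
    (hδ : (d * M + ‖p‖) * δ ≤ ε) (h : ∀ ξ ∈ T, |inner ℝ p ξ| + ε ≤ k ξ ∧ k ξ ≤ M) (η : RSp d) :
    |inner ℝ p η| ≤ k η := by
  refine hk.abs_inner_le_of_unit (fun η hη => ?_) η
  obtain ⟨ξ, hξT, hξ⟩ := hT η hη
  -- Passing from `η` to a net point costs at most `d * M * δ` in `k` and `‖p‖ * δ` in the pairing;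
  -- by `hδ` the margin `ε` absorbs both.
  have h1 : k ξ ≤ k η + d * M * δ := by
    have h2 := hk.map_add_le η (ξ - η)
    rw [add_sub_cancel] at h2
    have h3 := hk.le_of_basis_le (fun i => (h _ (hb i)).2) (ξ - η)
    rw [norm_sub_rev] at h3
    have h4 : d * M * ‖η - ξ‖ ≤ d * M * δ := mul_le_mul_of_nonneg_left hξ (by positivity)
    linarith
  have h5 : |inner ℝ p η| ≤ |inner ℝ p ξ| + ‖p‖ * δ := by
    have h6 : inner ℝ p η = inner ℝ p ξ + inner ℝ p (η - ξ) := by rw [← inner_add_right]; simp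
    rw [h6]
    refine (abs_add_le _ _).trans (add_le_add le_rfl ((abs_real_inner_le_norm _ _).trans ?_))
    exact mul_le_mul_of_nonneg_left hξ (norm_nonneg _)
  have := (h ξ hξT).1
  linarith

/-- Existence of a supporting functional at a given point. -/
theorem exists_inner_eq (hk : IsSymmSublinear k) (ξ : RSp d) :
    ∃ p : RSp d, inner ℝ p ξ = k ξ ∧ ∀ η, |inner ℝ p η| ≤ k η := by
  rcases eq_or_ne ξ 0 with rfl | hξ
  · exact ⟨0, by simp [hk.map_zero], fun η => by simpa using hk.nonneg η⟩
  -- Hahn-Banach extension of `s • ξ ↦ s * k ξ` from the line spanned by `ξ`, under the domination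
  -- by `k`.
  obtain ⟨g, hg, hgk⟩ := exists_extension_of_le_sublinear
    (LinearPMap.mkSpanSingleton ξ (k ξ) hξ) k hk.smul_pos hk.map_add_le (by
      rintro ⟨x, hx⟩
      obtain ⟨s, rfl⟩ := Submodule.mem_span_singleton.1 hx
      have hs : LinearPMap.mkSpanSingleton ξ (k ξ) hξ ⟨s • ξ, hx⟩ = s * k ξ :=
        LinearPMap.mkSpanSingleton'_apply _ _ _ s hx
      rw [hs, hk.map_smul]
      exact mul_le_mul_of_nonneg_right (le_abs_self s) (hk.nonneg ξ))
  have hip : ∀ η, inner ℝ ((InnerProductSpace.toDual ℝ (RSp d)).symm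
      (LinearMap.toContinuousLinearMap g)) η = g η := fun η => by
    rw [InnerProductSpace.toDual_symm_apply]
    rfl
  refine ⟨(InnerProductSpace.toDual ℝ (RSp d)).symm (LinearMap.toContinuousLinearMap g),
    (hip ξ).trans ((hg ⟨ξ, Submodule.mem_span_singleton_self ξ⟩).trans
      (LinearPMap.mkSpanSingleton_apply ℝ ℝ hξ _)), fun η => ?_⟩
  · rw [hip, abs_le]
    refine ⟨?_, hgk η⟩
    have := hgk (-η)
    rw [_root_.map_neg, hk.even] at this
    linarith

/-- For a nondegenerate `k`, near-supporting functionals at `ξ` lying strictly below `k` can be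
found in any dense set, off the hyperplane orthogonal to a given vector. -/
theorem exists_dense_near_support (hk : IsSymmSublinear k) {c : ℝ} (hc : 0 < c)
    (hkc : ∀ η : RSp d, ‖η‖ = 1 → c ≤ k η) {S : Set (RSp d)} (hS : Dense S) (ξ : RSp d)
    {w : RSp d} (hw : w ≠ 0) {δ : ℝ} (hδ : 0 < δ) :
    ∃ p ∈ S, k ξ - δ ≤ inner ℝ p ξ ∧ inner ℝ p w ≠ 0 ∧
      ∃ ε > 0, ∀ η : RSp d, ‖η‖ = 1 → |inner ℝ p η| + ε ≤ k η := by
  obtain ⟨p₀, hp₀, hp₀k⟩ := hk.exists_inner_eq ξ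
  have hkξ := hk.nonneg ξ
  -- Scaling `p₀` by `1 - θ` opens a gap of at least `θ * c` below `k` on the unit sphere and loses
  -- at most `δ / 2` at `ξ`.
  obtain ⟨θ, hθ0, hθ1, hθδ⟩ : ∃ θ : ℝ, 0 < θ ∧ θ ≤ 1 ∧ θ * k ξ ≤ δ / 2 := by
    refine ⟨min 1 (δ / 2 / (k ξ + 1)), by positivity, min_le_left _ _, ?_⟩
    calc min 1 (δ / 2 / (k ξ + 1)) * k ξ ≤ δ / 2 / (k ξ + 1) * (k ξ + 1) :=
          mul_le_mul (min_le_right _ _) (by linarith) hkξ (by positivity)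
      _ = δ / 2 := by field_simp
  set p₁ : RSp d := (1 - θ) • p₀ with hp₁
  -- A perturbation of size `ρ` uses at most half of that gap and loses at most another `δ / 2` at
  -- `ξ`.
  obtain ⟨ρ, hρ0, hρθ, hρδ⟩ : ∃ ρ : ℝ, 0 < ρ ∧ ρ ≤ θ * c / 2 ∧ ρ * ‖ξ‖ ≤ δ / 2 := by
    refine ⟨min (θ * c / 2) (δ / 2 / (‖ξ‖ + 1)), by positivity, min_le_left _ _, ?_⟩
    calc min (θ * c / 2) (δ / 2 / (‖ξ‖ + 1)) * ‖ξ‖ ≤ δ / 2 / (‖ξ‖ + 1) * (‖ξ‖ + 1) :=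
          mul_le_mul (min_le_right _ _) (by linarith) (norm_nonneg _) (by positivity)
      _ = δ / 2 := by field_simp
  have hopen : IsOpen (Metric.ball p₁ ρ ∩ {p | inner ℝ p w ≠ 0}) :=
    Metric.isOpen_ball.inter (isOpen_ne.preimage (f := fun p : RSp d => inner ℝ p w)
      (continuous_id.inner continuous_const))
  have hne : (Metric.ball p₁ ρ ∩ {p | inner ℝ p w ≠ 0}).Nonempty := by
    by_cases h : inner ℝ p₁ w = 0
    · have hw' : 0 < ‖w‖ := norm_pos_iff.2 hw
      refine ⟨p₁ + (ρ / (2 * ‖w‖)) • w, ?_, ?_⟩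
      · rw [Metric.mem_ball, dist_eq_norm, add_sub_cancel_left, norm_smul,
          Real.norm_of_nonneg (by positivity)]
        have : ρ / (2 * ‖w‖) * ‖w‖ = ρ / 2 := by field_simp
        linarith
      · rw [Set.mem_ofPred_eq, inner_add_left, h, zero_add, inner_smul_left,
          real_inner_self_eq_norm_sq]
        simp only [conj_trivial]
        positivity
    · exact ⟨p₁, Metric.mem_ball_self hρ0, h⟩
  obtain ⟨p, ⟨hpb, hpw⟩, hpS⟩ := hS.inter_open_nonempty _ hopen hne
  rw [Metric.mem_ball, dist_eq_norm] at hpb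
  have hdiff : ∀ η, |inner ℝ p η - (1 - θ) * inner ℝ p₀ η| ≤ ρ * ‖η‖ := fun η => by
    have : inner ℝ p η - (1 - θ) * inner ℝ p₀ η = inner ℝ (p - p₁) η := by
      rw [inner_sub_left, hp₁, inner_smul_left]
      simp
    rw [this]
    exact (abs_real_inner_le_norm _ _).trans
      (mul_le_mul_of_nonneg_right hpb.le (norm_nonneg _))
  refine ⟨p, hpS, ?_, hpw, θ * c / 2, by positivity, fun η hη => ?_⟩
  · have h1 := (abs_le.1 (hdiff ξ)).1
    rw [hp₀] at h1
    linarith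
  · have h1 := hdiff η
    rw [hη, mul_one] at h1
    have h2 : |inner ℝ p η| ≤ |(1 - θ) * inner ℝ p₀ η| + ρ := by
      have := abs_sub_abs_le_abs_sub (inner ℝ p η) ((1 - θ) * inner ℝ p₀ η)
      linarith
    have h3 : |(1 - θ) * inner ℝ p₀ η| ≤ (1 - θ) * k η := by
      rw [abs_mul, abs_of_nonneg (by linarith)]
      exact mul_le_mul_of_nonneg_left (hp₀k η) (by linarith)
    have h4 : θ * c ≤ θ * k η := mul_le_mul_of_nonneg_left (hkc η hη) hθ0.le
    linarith

end IsSymmSublinear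

/-! ### Cutoffs and the Sobolev weight. -/

/-- Smooth compactly supported cutoff functions with values in `[0, 1]`. -/
theorem exists_contDiff_cutoff {E : Type*} [NormedAddCommGroup E] [NormedSpace ℝ E]
    [FiniteDimensional ℝ E] {K U : Set E} (hK : IsCompact K) (hU : IsOpen U) (hKU : K ⊆ U) :
    ∃ ζ : E → ℝ, ContDiff ℝ (⊤ : ℕ∞) ζ ∧ HasCompactSupport ζ ∧ tsupport ζ ⊆ U ∧
      (∀ x ∈ K, ζ x = 1) ∧ ∀ x, 0 ≤ ζ x ∧ ζ x ≤ 1 := by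
  obtain ⟨L, hL, hKL, hLU⟩ := exists_compact_between hK hU hKU
  obtain ⟨f, hf1, hf0, hf⟩ := exists_contMDiffMap_one_nhds_of_subset_interior
    (n := (⊤ : ℕ∞)) (modelWithCornersSelf ℝ E) hK.isClosed hKL
  have hs : tsupport f ⊆ L := closure_minimal
    (fun x hx => by_contra fun h => hx (hf0 x h)) hL.isClosed
  exact ⟨f, contMDiff_iff_contDiff.1 f.contMDiff, hL.of_isClosed_subset (isClosed_tsupport _) hs,
    hs.trans hLU, fun x hx => hf1.self_of_nhdsSet x hx, hf⟩

/-- A Sobolev weight with values in `[0, 1]`, which vanishes where `|⟪p, ·⟫| ≤ κ x` fails and equals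
one at the points of a compact set where that inequality holds with a margin. -/
theorem exists_sobolev_weight {d : ℕ} {Ω : Set (RSp d)} (hΩ : IsOpen Ω) {κ : RSp d → RSp d → ℝ}
    (hκ : ∀ ξ, MemW11 Ω (fun x => κ x ξ)) (hk : ∀ x ∈ Ω, IsSymmSublinear (κ x)) (p : RSp d)
    {ε M : ℝ} (hε : 0 < ε) (hM : 0 ≤ M) {C : Set (RSp d)} (hC : IsCompact C) (hCΩ : C ⊆ Ω) :
    ∃ l : RSp d → ℝ, (∀ x, 0 ≤ l x ∧ l x ≤ 1) ∧
      (∃ D : RSp d → (RSp d →L[ℝ] ℝ), Integrable D ∧ HasWeakDerivOn Set.univ l D) ∧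
      (∀ x ∈ Ω, l x ≠ 0 → ∀ η, |inner ℝ p η| ≤ κ x η) ∧
      ∀ x ∈ C, (∀ η : RSp d, ‖η‖ = 1 → |inner ℝ p η| + 2 * ε ≤ κ x η ∧ κ x η ≤ M) → l x = 1 := by
  obtain ⟨ζ, hζ, hζc, hζΩ, hζ1, hζ01⟩ := exists_contDiff_cutoff hC hΩ hCΩ
  -- Mesh required by `abs_inner_le_of_net` with the bound `M + 1`, the upper edge of the box
  -- containing the support of `Φ`; the final `+ 1` keeps the denominator positive.
  set δ : ℝ := ε / (d * (M + 1) + ‖p‖ + 1) with hδ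
  have hδ0 : 0 < δ := by positivity
  have hδε : (d * (M + 1) + ‖p‖) * δ ≤ ε := by
    calc (d * (M + 1) + ‖p‖) * δ ≤ (d * (M + 1) + ‖p‖ + 1) * δ :=
          mul_le_mul_of_nonneg_right (by linarith) hδ0.le
      _ = ε := by rw [hδ]; field_simp
  obtain ⟨T₀, hT₀s, hT₀f, hT₀⟩ := (isCompact_sphere (0 : RSp d) 1).finite_cover_balls hδ0
  -- The basis vectors are added because bounds at them control a sublinear function everywhere.
  set T : Set (RSp d) := T₀ ∪ Set.range (EuclideanSpace.basisFun (Fin d) ℝ) with hT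
  have hTf : T.Finite := hT₀f.union (Set.finite_range _)
  have hT1 : ∀ ξ ∈ T, ‖ξ‖ = 1 := by
    rintro ξ (h | ⟨i, rfl⟩)
    · simpa using hT₀s h
    · simp
  have hTnet : ∀ η : RSp d, ‖η‖ = 1 → ∃ ξ ∈ T, ‖η - ξ‖ ≤ δ := fun η hη => by
    obtain ⟨ξ, hξ, hηξ⟩ := Set.mem_iUnion₂.1 (hT₀ (mem_sphere_zero_iff_norm.2 hη))
    exact ⟨ξ, Or.inl hξ, by simpa [dist_eq_norm] using (Metric.mem_ball.1 hηξ).le⟩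
  have : Fintype T := hTf.fintype
  obtain ⟨Φ, hΦ, hΦc, hΦU, hΦ1, hΦ01⟩ := exists_contDiff_cutoff
    (K := Set.pi Set.univ fun ξ : T => Set.Icc (|inner ℝ p (ξ : RSp d)| + 2 * ε) M)
    (U := Set.pi Set.univ fun ξ : T => Set.Ioo (|inner ℝ p (ξ : RSp d)| + ε) (M + 1))
    (isCompact_univ_pi fun _ => isCompact_Icc)
    (isOpen_set_pi Set.finite_univ fun _ _ => isOpen_Ioo)
    (Set.pi_mono fun ξ _ => Set.Icc_subset_Ioo (by linarith) (by linarith))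
  refine ⟨fun x => Φ fun ξ : T => ζ x * κ x ξ, fun x => hΦ01 _,
    exists_integrable_hasWeakDerivOn_comp_cutoff (fun ξ : T => hκ ξ) hζ hζc hζΩ hΦ hΦc,
    fun x hx hne η => ?_, fun x hx h => hΦ1 _ ?_⟩
  -- A nonzero weight puts the sampled values in the open box, so the net argument applies to `ζ x *
  -- κ x ·`, which is at most `κ x ·`.
  · have hmem := hΦU (subset_tsupport _ (Function.mem_support.2 hne))
    have h1 := ((hk x hx).const_mul (hζ01 x).1).abs_inner_le_of_net (p := p)
      (fun i => Or.inr ⟨i, rfl⟩) hTnet (by linarith) hδε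
      (fun ξ hξ => ⟨(hmem ⟨ξ, hξ⟩ trivial).1.le, (hmem ⟨ξ, hξ⟩ trivial).2.le⟩) η
    exact h1.trans (mul_le_of_le_one_left ((hk x hx).nonneg η) (hζ01 x).2)
  · intro ξ _
    simpa [hζ1 x hx] using h ξ (hT1 ξ ξ.2)

/-! ### Ramps, ridge potentials and separated fields. -/

/-- The piecewise linear ramp `s ↦ n (s - q)` truncated to `[0, 1]`. -/
noncomputable def truncatedRamp (n q s : ℝ) : ℝ := max 0 (min 1 (n * (s - q)))

theorem truncatedRamp_mem (n q s : ℝ) : 0 ≤ truncatedRamp n q s ∧ truncatedRamp n q s ≤ 1 :=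
  ⟨le_max_left _ _, max_le zero_le_one (min_le_left _ _)⟩

theorem abs_truncatedRamp_sub_le (n q s t : ℝ) :
    |truncatedRamp n q s - truncatedRamp n q t| ≤ |n| * |s - t| := by
  have h1 := abs_max_sub_max_le_abs (min 1 (n * (s - q))) (min 1 (n * (t - q))) 0
  have h2 := abs_min_sub_min_le_max 1 (n * (s - q)) 1 (n * (t - q))
  rw [sub_self, abs_zero, max_eq_right (abs_nonneg _), ← mul_sub, abs_mul,
    sub_sub_sub_cancel_right] at h2
  rw [max_comm, max_comm _ (0 : ℝ)] at h1
  exact h1.trans h2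

theorem continuous_truncatedRamp (n q : ℝ) : Continuous (truncatedRamp n q) := by
  unfold truncatedRamp
  fun_prop

/-- Ramps with rational data separate any two real numbers. -/
theorem exists_truncatedRamp_separating {a b : ℝ} (hab : a ≠ b) :
    ∃ (n : ℤ) (q : ℚ), truncatedRamp n q a = 1 ∧ truncatedRamp n q b = 0 := by
  have key : ∀ n q : ℝ, 1 ≤ n * (a - q) → n * (b - q) ≤ 0 →
      truncatedRamp n q a = 1 ∧ truncatedRamp n q b = 0 := fun n q h1 h2 => by
    unfold truncatedRamp
    rw [min_eq_left h1, min_eq_right (by linarith), max_eq_right zero_le_one, max_eq_left h2]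
    exact ⟨rfl, rfl⟩
  -- The ramp must be `1` at `a`, so its slope is negative when `a < b`; a size of at least `1 / |a
  -- - q|` reaches the value `1` there.
  rcases hab.lt_or_gt with h | h
  · obtain ⟨q, hq1, hq2⟩ := exists_rat_btwn h
    obtain ⟨N, hN⟩ := exists_nat_ge (1 / (q - a))
    refine ⟨-N, q, key _ _ ?_ ?_⟩
    · rw [div_le_iff₀ (by linarith)] at hN
      push_cast
      linarith
    · push_cast
      have : 0 ≤ (N : ℝ) * (b - q) := mul_nonneg N.cast_nonneg (by linarith)
      linarith
  · obtain ⟨q, hq1, hq2⟩ := exists_rat_btwn h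
    obtain ⟨N, hN⟩ := exists_nat_ge (1 / (a - q))
    refine ⟨N, q, key _ _ ?_ ?_⟩
    · rw [div_le_iff₀ (by linarith)] at hN
      exact_mod_cast hN
    · have : 0 ≤ (N : ℝ) * (q - b) := mul_nonneg N.cast_nonneg (by linarith)
      push_cast
      linarith

/-- The field `r ↦ ψ(⟪p, r⟫) p` with a continuous profile `ψ` has a `C¹` potential. -/
theorem exists_potential_ridge {d : ℕ} {ψ : ℝ → ℝ} (hψ : Continuous ψ) (p : RSp d) :
    ∃ G : RSp d → ℝ, ContDiff ℝ 1 G ∧ ∀ r, HasGradientAt G (ψ (inner ℝ p r) • p) r := by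
  have hd : ∀ s, HasDerivAt (fun u => ∫ y in (0 : ℝ)..u, ψ y) (ψ s) s := fun s =>
    intervalIntegral.integral_hasDerivAt_right (hψ.intervalIntegrable _ _)
      hψ.stronglyMeasurable.stronglyMeasurableAtFilter hψ.continuousAt
  have hc : ContDiff ℝ 1 (fun u => ∫ y in (0 : ℝ)..u, ψ y) := by
    rw [contDiff_one_iff_deriv]
    refine ⟨fun s => (hd s).differentiableAt, ?_⟩
    rwa [funext fun s => (hd s).deriv]
  refine ⟨fun r => ∫ y in (0 : ℝ)..inner ℝ p r, ψ y, hc.comp (innerSL ℝ p).contDiff, fun r => ?_⟩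
  rw [hasGradientAt_iff_hasFDerivAt]
  have h := (hd (inner ℝ p r)).comp_hasFDerivAt r (innerSL ℝ p).hasFDerivAt
  have he : InnerProductSpace.toDual ℝ (RSp d) (ψ (inner ℝ p r) • p) =
      ψ (inner ℝ p r) • innerSL ℝ p := by
    ext v
    simp
  rw [he]
  exact h

/-- Fields `(x, r) ↦ l(x) a(r)` with separated variables satisfy all the regularity conditions. -/
theorem regularity_of_separated {d : ℕ} {l : RSp d → ℝ} (hl : ∀ x, 0 ≤ l x ∧ l x ≤ 1)
    {D : RSp d → (RSp d →L[ℝ] ℝ)} (hD : HasWeakDerivOn Set.univ l D) {a : RSp d → RSp d}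
    {A : ℝ} (ha : ∀ r, ‖a r‖ ≤ A) {L : ℝ} (hL : 0 ≤ L) (hLip : ∀ r s, ‖a r - a s‖ ≤ L * ‖r - s‖)
    (hpot : ∃ G : RSp d → ℝ, ContDiff ℝ 1 G ∧ ∀ r, HasGradientAt G (a r) r) :
    CondG1 (fun x r => l x • a r) ∧ CondG2 (fun x r => l x • a r) ∧
      CondG3' (fun x r => l x • a r) ∧ CondG6 (fun x r => l x • a r) := by
  have hA : 0 ≤ A := (norm_nonneg _).trans (ha 0)
  obtain ⟨hl1, hD1, hw⟩ := hD
  rw [locallyIntegrableOn_univ] at hl1 hD1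
  have hweak : ∀ r, HasWeakDerivOn Set.univ (fun x => l x • a r)
      (fun x => (D x).smulRight (a r)) := fun r => by
    have h1 : LocallyIntegrable (fun x => l x • a r) := hl1.smul_continuous continuous_const
    have h2 : LocallyIntegrable (fun x => (D x).smulRight (a r)) := fun x => by
      obtain ⟨U, hU, hDU⟩ := hD1 x
      exact ⟨U, hU,
        ((ContinuousLinearMap.smulRightL ℝ (RSp d) (RSp d)).flip (a r)).integrable_comp hDU⟩
    refine ⟨h1.locallyIntegrableOn _, h2.locallyIntegrableOn _, fun ψ hψ hψc hψu v => ?_⟩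
    have h3 := hw ψ hψ hψc hψu v
    simp only [ContinuousLinearMap.smulRight_apply, smul_smul]
    rw [integral_smul_const, integral_smul_const, ← neg_smul]
    simp only [smul_eq_mul] at h3
    rw [h3]
  -- With the modulus `min 1 s`, the constant `L` handles `‖r - s‖ ≤ 1` and `2 * A` handles larger
  -- distances. The added ones make the weights strictly positive. The exceptional sets for the last
  -- two conditions are empty.
  refine ⟨⟨fun r => ⟨_, hweak r⟩, fun _ => A + 1, ⟨fun _ => by positivity,
    locallyIntegrable_const _⟩, Eventually.of_forall fun x r => ?_⟩, ⟨_, hweak,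
    fun x => (L + 2 * A + 1) * (‖D x‖ + 1), ⟨fun _ => by positivity, ?_⟩,
    fun s => min 1 s, ⟨fun s t h => min_le_min le_rfl h, by simp, by fun_prop⟩,
    fun s => min_le_left _ _, Eventually.of_forall fun x r s => ?_⟩,
    ⟨⟨L, hL⟩, Eventually.of_forall fun x r t => ?_⟩, ∅, measure_empty, fun x _ => ?_⟩
  · rw [norm_smul, Real.norm_of_nonneg (hl x).1]
    have := mul_le_of_le_one_left (norm_nonneg (a r)) (hl x).2
    linarith [ha r]
  · have hn : LocallyIntegrable (fun x => ‖D x‖) := fun x => by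
      obtain ⟨U, hU, hDU⟩ := hD1 x
      exact ⟨U, hU, hDU.norm⟩
    exact (hn.add (locallyIntegrable_const 1)).smul (L + 2 * A + 1)
  · have h1 : (D x).smulRight (a r) - (D x).smulRight (a s) = (D x).smulRight (a r - a s) := by
      ext v
      simp [mul_sub]
    have h2 : ‖a r - a s‖ ≤ (L + 2 * A + 1) * min 1 (nndist r s : ℝ) := by
      rw [coe_nndist, dist_eq_norm]
      rcases le_total 1 ‖r - s‖ with h | h
      · rw [min_eq_left h]
        linarith [norm_sub_le (a r) (a s), ha r, ha s]
      · rw [min_eq_right h]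
        refine (hLip r s).trans (mul_le_mul_of_nonneg_right (by linarith) (norm_nonneg _))
    rw [h1, ContinuousLinearMap.norm_smulRight_apply]
    have h3 : ((min 1 (nndist r s) : ℝ≥0) : ℝ) = min 1 (nndist r s : ℝ) := by simp
    rw [h3]
    calc ‖D x‖ * ‖a r - a s‖ ≤ (‖D x‖ + 1) * ((L + 2 * A + 1) * min 1 (nndist r s : ℝ)) :=
          mul_le_mul (by linarith) h2 (norm_nonneg _) (by positivity)
      _ = _ := by ring
  · rw [← smul_sub, norm_smul, Real.norm_of_nonneg (hl x).1]
    exact (mul_le_of_le_one_left (norm_nonneg _) (hl x).2).trans (hLip r t)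
  · obtain ⟨G, hG, hGa⟩ := hpot
    refine ⟨fun r => l x * G r, contDiff_const.mul hG, fun r => ?_⟩
    rw [hasGradientAt_iff_hasFDerivAt]
    have he : InnerProductSpace.toDual ℝ (RSp d) (l x • a r) =
        l x • InnerProductSpace.toDual ℝ (RSp d) (a r) := by
      ext v
      simp
    rw [he]
    exact (hasGradientAt_iff_hasFDerivAt.1 (hGa r)).const_mul (l x)

/-! ### Assembly of the countable family of fields. -/

theorem proposition4p4 {d : ℕ} (Ω : Set (RSp d)) (hΩ : IsOpen Ω) (hΩb : Bornology.IsBounded Ω)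
    (φ : RSp d → RSp d → RSp d → RSp d → ℝ) (κ : RSp d → RSp d → ℝ) (c : ℝ) (hc : 0 < c)
    (hφ : ∀ x ∈ Ω, ∀ r t, r ≠ t → ∀ ξ, φ x r t ξ = κ x ξ)
    (hφdiag : ∀ x ∈ Ω, ∀ r ξ, φ x r r ξ = 0)
    (hφc : ∀ x ∈ Ω, ∀ r t, r ≠ t → ∀ ξ, ‖ξ‖ = 1 → c ≤ φ x r t ξ)
    (hK1 : ∀ ξ, MemW11 Ω (fun x => κ x ξ))
    (hK2 : ∃ Dκ : RSp d → RSp d → (RSp d →L[ℝ] ℝ),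
      (∀ ξ, HasWeakDerivOn Ω (fun x => κ x ξ) (fun x => Dκ x ξ)) ∧
      ∃ h : RSp d → ℝ, IsPosLocInt h ∧ ∃ ω : ℝ≥0 → ℝ≥0, IsModulus ω ∧
        ∀ᵐ x ∂volume.restrict Ω, ∀ ξ ξ', ‖Dκ x ξ - Dκ x ξ'‖ ≤ (ω (nndist ξ ξ') : ℝ) * h x)
    (hK3 : ∀ x ∈ Ω, (∀ ξ, κ x (-ξ) = κ x ξ) ∧
      (∀ s : ℝ, 0 < s → ∀ ξ, κ x (s • ξ) = s * κ x ξ) ∧ ConvexOn ℝ Set.univ (κ x)) :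
    IsNASymmetricJointlyConvex Ω φ := by
  have hk : ∀ x ∈ Ω, IsSymmSublinear (κ x) := fun x hx =>
    ⟨(hK3 x hx).1, (hK3 x hx).2.1, (hK3 x hx).2.2⟩
  have hφ0 : ∀ x ∈ Ω, ∀ r t ξ, 0 ≤ φ x r t ξ := fun x hx r t ξ => by
    rcases eq_or_ne r t with rfl | h
    · rw [hφdiag x hx]
    · rw [hφ x hx r t h]
      exact (hk x hx).nonneg ξ
  obtain ⟨C, hC, hCΩ⟩ : IsSigmaCompact Ω := by
    have := hΩ.locallyCompactSpace
    exact isSigmaCompact_iff_sigmaCompactSpace.2 inferInstance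
  have hCsub : ∀ j, C j ⊆ Ω := fun j => hCΩ ▸ Set.subset_iUnion C j
  let P : ℕ → RSp d := TopologicalSpace.denseSeq (RSp d)
  -- The index `m` governs both the margin `2 / (m + 1)` and the upper bound `m`; `j` selects the
  -- compact set on which the weight can reach `1`.
  choose l hl01 hlD hlκ hl1 using fun i m j : ℕ =>
    exists_sobolev_weight hΩ hK1 hk (P i) (ε := 1 / ((m : ℝ) + 1)) (M := m)
      (by positivity) (by positivity) (hC j) (hCsub j)
  obtain ⟨e, he⟩ := exists_surjective_nat (ℕ × ℕ × ℕ × ℤ × ℚ)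
  let a : ℕ × ℕ × ℕ × ℤ × ℚ → RSp d → RSp d := fun i r =>
    truncatedRamp i.2.2.2.1 i.2.2.2.2 (inner ℝ (P i.1) r) • P i.1
  let w : ℕ × ℕ × ℕ × ℤ × ℚ → RSp d → ℝ := fun i => l i.1 i.2.1 i.2.2.1
  have ha : ∀ i r, ‖a i r‖ ≤ ‖P i.1‖ := fun i r => by
    rw [norm_smul, Real.norm_of_nonneg (truncatedRamp_mem _ _ _).1]
    exact mul_le_of_le_one_left (norm_nonneg _) (truncatedRamp_mem _ _ _).2
  have hinner : ∀ i x r t ξ, inner ℝ (w i x • a i r - w i x • a i t) ξ =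
      w i x * (truncatedRamp i.2.2.2.1 i.2.2.2.2 (inner ℝ (P i.1) r) -
        truncatedRamp i.2.2.2.1 i.2.2.2.2 (inner ℝ (P i.1) t)) * inner ℝ (P i.1) ξ :=
    fun i x r t ξ => by
      rw [← smul_sub, ← sub_smul, smul_smul, inner_smul_left]
      simp
  refine ⟨hφ0, fun n x r => w (e n) x • a (e n) r, fun n => ⟨‖P (e n).1‖, fun x r => ?_⟩,
    fun x hx r t ξ => ?_, fun n => ?_⟩
  · rw [norm_smul, Real.norm_of_nonneg (hl01 _ _ _ x).1]
    exact (mul_le_of_le_one_left (norm_nonneg _) (hl01 _ _ _ x).2).trans (ha _ r)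
  · rcases eq_or_ne r t with rfl | hrt
    · simp [hφdiag x hx, isLUB_singleton]
    rw [hφ x hx r t hrt]
    refine ⟨?_, fun b hb => ?_⟩
    · rintro _ ⟨n, rfl⟩
      simp only [hinner]
      set i := e n
      by_cases h0 : w i x = 0
      · simpa [h0] using (hk x hx).nonneg ξ
      refine (le_abs_self _).trans ?_
      rw [abs_mul]
      refine le_trans (mul_le_of_le_one_left (abs_nonneg _) ?_) (hlκ _ _ _ x hx h0 ξ)
      rw [abs_mul, abs_of_nonneg (hl01 _ _ _ x).1]
      refine mul_le_one₀ (hl01 _ _ _ x).2 (abs_nonneg _) (abs_le.2 ⟨?_, ?_⟩) <;>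
      linarith [(truncatedRamp_mem i.2.2.2.1 i.2.2.2.2 (inner ℝ (P i.1) r)).1,
        (truncatedRamp_mem i.2.2.2.1 i.2.2.2.2 (inner ℝ (P i.1) r)).2,
        (truncatedRamp_mem i.2.2.2.1 i.2.2.2.2 (inner ℝ (P i.1) t)).1,
        (truncatedRamp_mem i.2.2.2.1 i.2.2.2.2 (inner ℝ (P i.1) t)).2]
    · refine le_of_forall_pos_le_add fun δ hδ => ?_
      -- The lower bound on `κ x` is read off from `φ` at the present pair `r ≠ t`.
      have hkc : ∀ η : RSp d, ‖η‖ = 1 → c ≤ κ x η := fun η hη =>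
        hφ x hx r t hrt η ▸ hφc x hx r t hrt η hη
      obtain ⟨p, ⟨i, rfl⟩, hpξ, hpw, ε, hε, hpε⟩ := (hk x hx).exists_dense_near_support hc hkc
        (TopologicalSpace.denseRange_denseSeq (RSp d)) ξ (sub_ne_zero.2 hrt) hδ
      rw [inner_sub_right, sub_ne_zero] at hpw
      obtain ⟨n, q, hn1, hn0⟩ := exists_truncatedRamp_separating hpw
      obtain ⟨j, hj⟩ := Set.mem_iUnion.1 (hCΩ ▸ hx)
      obtain ⟨B, hB⟩ : ∃ B : ℝ, ∀ s, κ x (EuclideanSpace.basisFun (Fin d) ℝ s) ≤ B :=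
        ⟨∑ s, κ x (EuclideanSpace.basisFun (Fin d) ℝ s), fun s =>
          Finset.single_le_sum (f := fun s => κ x (EuclideanSpace.basisFun (Fin d) ℝ s))
            (fun s _ => (hk x hx).nonneg _) (Finset.mem_univ s)⟩
      -- The first entry makes the margin `2 / (m + 1)` at most `ε`; the second makes `m` a bound
      -- for `κ x` on the unit sphere.
      obtain ⟨m, hm⟩ := exists_nat_ge (max (2 / ε) (d * B))
      have hl : l i m j x = 1 := hl1 i m j x hj fun η hη => by
        constructor
        · have h1 : 2 * (1 / ((m : ℝ) + 1)) ≤ ε := by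
            have := (le_max_left _ _).trans hm
            rw [div_le_iff₀ hε] at this
            rw [mul_one_div, div_le_iff₀ (by positivity)]
            linarith
          linarith [hpε η hη]
        · have := (hk x hx).le_of_basis_le hB η
          rw [hη, mul_one] at this
          exact this.trans ((le_max_right _ _).trans hm)
      obtain ⟨N, hN⟩ := he (i, m, j, n, q)
      have hbN := hb ⟨N, rfl⟩
      simp only [hinner, hN] at hbN
      -- With weight `1` and ramp values `1` and `0`, the field contributes exactly `⟪p, ξ⟫`, which
      -- is at least `κ x ξ - δ`.
      simp only [w, P, hl, hn1, hn0] at hbN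
      linarith
  · obtain ⟨D, -, hD⟩ := hlD (e n).1 (e n).2.1 (e n).2.2.1
    refine regularity_of_separated (hl01 _ _ _) hD (ha (e n))
      (L := |((e n).2.2.2.1 : ℝ)| * ‖P (e n).1‖ * ‖P (e n).1‖) (by positivity) (fun r s => ?_)
      (exists_potential_ridge (continuous_truncatedRamp _ _) _)
    rw [← sub_smul, norm_smul, Real.norm_eq_abs]
    calc _ ≤ |((e n).2.2.2.1 : ℝ)| * (‖P (e n).1‖ * ‖r - s‖) * ‖P (e n).1‖ := by
          refine mul_le_mul_of_nonneg_right ((abs_truncatedRamp_sub_le _ _ _ _).trans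
            (mul_le_mul_of_nonneg_left ?_ (abs_nonneg _))) (norm_nonneg _)
          rw [← inner_sub_right]
          exact abs_real_inner_le_norm _ _
      _ = _ := by ring
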